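/- For a finite simple graph $G$ and $q\in\mathbb{N}$, let $c(G,q)$ denote the number of proper $q$-colorings of $G$ (with colors from $\{1,\dots,q\}$). (1) There is an absolute constant $C$ such that for every integer $\Delta\ge 0$ and every $n$-vertex triangle-free graph $G$ of maximum degree at most $\Delta$, \[ c(G,\Delta+1)\ \ge\ \left(\max\left\{0,\ \frac{\Delta}{\sqrt e}-C\right\}\right)^{n}. \] (2) The conclusion of (1) fails for graphs with triangles. For integers $\Delta,k\ge 0$, let $G_{\Delta,k}$ be the disjoint union of $k$ cliques with $\Delta+1$ vertices each, so that it has $n=k(\Delta+1)$ vertices. Then \[ c(G_{\Delta,k},\Delta+1)=\bigl((\Delta+1)!\bigr)^{k}=\left(\frac{\Delta}{e}+g(\Delta)\right)^{n} \] for some function $g$, depending only on $\Delta$, with $g(\Delta)=o(\Delta)$ as $\Delta\to\infty$. In particular, for every real $C$ there is $\Delta_0$ such that for all $\Delta\ge\Delta_0$ and all $k\ge 1$, the graph $G_{\Delta,k}$ has maximum degree $\Delta$, contains a triangle, and satisfies \[ c(G_{\Delta,k},\Delta+1)\ <\ \left(\max\left\{0,\ \frac{\Delta}{\sqrt e}-C\right\}\right)^{n}.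 \] Here $0^0=1$. -/

import Mathlib

open Filter Asymptotics

/-- The number `c(G, q)` of proper `q`-colorings of the graph `G`. -/
noncomputable def numColorings {V : Type*} (G : SimpleGraph V) (q : ℕ) : ℕ :=
  Nat.card (G.Coloring (Fin q))

/-- The disjoint union of `k` cliques with `s` vertices each. The vertex `(i, a)` is the `a`-th
vertex of the `i`-th clique. -/
def disjointCliques (k s : ℕ) : SimpleGraph (Fin k × Fin s) where
  Adj x y := x.1 = y.1 ∧ x.2 ≠ y.2
  symm := ⟨fun _ _ h => ⟨h.1.symm, h.2.symm⟩⟩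
  loopless := ⟨fun _ h => h.2 rfl⟩

instance (k s : ℕ) : DecidableRel (disjointCliques k s).Adj :=
  fun x y => inferInstanceAs (Decidable (x.1 = y.1 ∧ x.2 ≠ y.2))

/-!
Let `q = Δ + 1`, let `v` be a vertex of the triangle-free graph `G`, and let `H` be `G` with `v`
isolated. A uniformly random coloring of `H` colors `G` if the color of `v` differs from those of
its neighbors. As `N(v)` is independent, conditioning on the colors outside `N(v)` makes the colors
of the neighbors `u` independent and uniform on lists `L u` of free colors
(`sum_mul_prod_indicator_eq`, `card_properOff_eq_sum`), of size at least two by the degree bound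
(`two_le_card_freeColors`). Since `1 - 1 / l ≥ exp (-(1 + 2 / l) / l)` for `l ≥ 2`, and a list
contains the uniform color of `v` with probability `#(L u) / q`, Jensen's inequality bounds
`c(G) / c(H)` from below by `exp (-∑ u, E (1 + 2 / #(L u)) / q)`
(`card_mul_exp_le_card_properOff`).

What is needed is that `E (1 / #(L u)) = O(1 / q)`. In a random coloring of `H`, the list `L u` has
its distribution in a random coloring of `H - u` biased by its size, so this mean is the ratio
`c(H - u) / c(H)`. The inequality of the previous paragraph, applied to `u` in `H` and with the
trivial estimate `#(L u) ≥ 2`, bounds it by `exp 2 / q`. Hence every edge costs a factor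
`exp (-(1 + O(1 / q)) / q)` (`card_properOff_deleteIncidenceSet_mul_exp_le`), and as there are at
most `n * Δ / 2` edges, induction gives `c(G, q) ≥ (q * exp (-1 / 2 - O(1 / q))) ^ n`.

For disjoint cliques, a coloring is a choice of an injection of each clique into the `Δ + 1` colors,
and Stirling's formula gives `((Δ + 1)!) ^ (1 / (Δ + 1)) ~ Δ / e`, which is smaller than `Δ / √e` by
a linear amount.
-/

section
open scoped Classical

variable {V : Type*} [Fintype V] {q : ℕ}

/-- The colors that `φ` uses on no `G`-neighbor of `u`; the color `φ u` itself plays no role. -/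
noncomputable def freeColors (G : SimpleGraph V) (φ : V → Fin q) (u : V) : Finset (Fin q) :=
  {c | ∀ w, G.Adj u w → φ w ≠ c}

/-- The maps `V → Fin q` that are proper on `G` with the vertices of `I` removed. The values on `I`
are unconstrained but counted, so the cardinality is `q ^ #I * c(G - I, q)`; keeping all of `V` as
the domain avoids comparing colorings of graphs on different vertex types. -/
noncomputable def properOff (G : SimpleGraph V) (q : ℕ) (I : Finset V) : Finset (V → Fin q) :=
  {φ | ∀ a b, a ∉ I → b ∉ I → G.Adj a b → φ a ≠ φ b}

/-! ### Resampling the colors of a set of vertices -/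

/-- Replacing the values of a uniformly random map on `I` by independent uniform ones changes no
expectation. So for `F` and `A` that do not look at the values on `I`, each event `φ u ∈ A u φ`
may be replaced by its conditional probability `#(A u φ) / q`. -/
theorem sum_mul_prod_indicator_eq (hq : 0 < q) (I : Finset V) (F : (V → Fin q) → ℝ)
    (A : V → (V → Fin q) → Finset (Fin q))
    (hF : ∀ φ ψ : V → Fin q, (∀ w ∉ I, φ w = ψ w) → F φ = F ψ)
    (hA : ∀ u ∈ I, ∀ φ ψ : V → Fin q, (∀ w ∉ I, φ w = ψ w) → A u φ = A u ψ) :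
    ∑ φ, F φ * ∏ u ∈ I, (if φ u ∈ A u φ then (1 : ℝ) else 0)
      = ∑ φ, F φ * ∏ u ∈ I, ((A u φ).card : ℝ) / q := by
  have hq' : (q : ℝ) ≠ 0 := by positivity
  -- `e` exchanges the values of two independent maps on `I`. As it is a bijection, the values of
  -- the first map on `I` may be read off the second one.
  let e : (V → Fin q) × (V → Fin q) → (V → Fin q) × (V → Fin q) :=
    fun p => (I.piecewise p.2 p.1, I.piecewise p.1 p.2)
  have he : Function.Involutive e := by
    rintro ⟨φ, χ⟩
    ext w <;> by_cases hw : w ∈ I <;> simp [e, hw]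
  have hswap : ∑ p : (V → Fin q) × (V → Fin q),
        F p.1 * ∏ u ∈ I, (if p.1 u ∈ A u p.1 then (1 : ℝ) else 0)
      = ∑ p : (V → Fin q) × (V → Fin q),
        F p.1 * ∏ u ∈ I, (if p.2 u ∈ A u p.1 then (1 : ℝ) else 0) := by
    refine Fintype.sum_equiv he.toPerm _ _ ?_
    rintro ⟨φ, χ⟩
    have hag : ∀ w ∉ I, φ w = I.piecewise χ φ w := fun w hw => by simp [hw]
    simp only [Function.Involutive.coe_toPerm, e]
    rw [hF _ _ hag]
    congr 1
    refine Finset.prod_congr rfl fun u hu => ?_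
    rw [hA u hu _ _ hag]
    simp [hu]
  have hχ : ∀ φ : V → Fin q,
      ∑ χ : V → Fin q, ∏ u ∈ I, (if χ u ∈ A u φ then (1 : ℝ) else 0)
        = (q : ℝ) ^ Fintype.card V * ∏ u ∈ I, ((A u φ).card : ℝ) / q := by
    intro φ
    have h1 : ∀ χ : V → Fin q, ∏ u ∈ I, (if χ u ∈ A u φ then (1 : ℝ) else 0)
        = ∏ u, (if u ∈ I then (if χ u ∈ A u φ then (1 : ℝ) else 0) else 1) := by
      intro χ
      rw [Fintype.prod_ite_mem]
    have h2 := Finset.prod_univ_sum (fun _ : V => (Finset.univ : Finset (Fin q)))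
      (fun u c => if u ∈ I then (if c ∈ A u φ then (1 : ℝ) else 0) else 1)
    rw [Fintype.piFinset_univ] at h2
    simp_rw [h1]
    rw [← h2, ← Fintype.prod_ite_mem I, ← Finset.card_univ, ← Finset.prod_const,
      ← Finset.prod_mul_distrib]
    refine Finset.prod_congr rfl fun u _ => ?_
    by_cases hu : u ∈ I
    · simp [hu, mul_div_cancel₀, hq']
    · simp [hu]
  refine mul_left_cancel₀ (pow_ne_zero (Fintype.card V) hq') ?_
  calc _ = ∑ φ : V → Fin q, ∑ _χ : V → Fin q,
        F φ * ∏ u ∈ I, (if φ u ∈ A u φ then (1 : ℝ) else 0) := by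
        rw [Finset.mul_sum]
        refine Finset.sum_congr rfl fun φ _ => ?_
        rw [Finset.sum_const, Finset.card_univ, Fintype.card_fun, Fintype.card_fin, nsmul_eq_mul,
          Nat.cast_pow]
    _ = ∑ φ : V → Fin q, ∑ χ : V → Fin q,
        F φ * ∏ u ∈ I, (if χ u ∈ A u φ then (1 : ℝ) else 0) := by
        rw [← Fintype.sum_prod_type', ← Fintype.sum_prod_type']
        exact hswap
    _ = _ := by
        rw [Finset.mul_sum]
        refine Finset.sum_congr rfl fun φ _ => ?_
        rw [← Finset.mul_sum, hχ, mul_left_comm]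

theorem freeColors_congr (G : SimpleGraph V) (u : V) {φ ψ : V → Fin q}
    (h : ∀ w, G.Adj u w → φ w = ψ w) : freeColors G φ u = freeColors G ψ u := by
  ext c
  simp only [freeColors, Finset.mem_filter, Finset.mem_univ, true_and]
  exact forall₂_congr fun w hw => by rw [h w hw]

theorem mem_properOff_congr (G : SimpleGraph V) (I : Finset V) {φ ψ : V → Fin q}
    (h : ∀ w, w ∉ I → (∃ x, G.Adj w x) → φ w = ψ w) :
    φ ∈ properOff G q I ↔ ψ ∈ properOff G q I := by
  simp only [properOff, Finset.mem_filter, Finset.mem_univ, true_and]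
  refine forall₅_congr fun a b ha hb hab => ?_
  rw [h a ha ⟨b, hab⟩, h b hb ⟨a, hab.symm⟩]

/-- Colorings of `G - J`, generated by first coloring off the independent set `I ⊇ J`: the vertices
of `I \ J` then choose independently from their free colors. -/
theorem card_properOff_eq_sum (hq : 0 < q) (G : SimpleGraph V) {I J : Finset V} (hJ : J ⊆ I)
    (hI : ∀ a ∈ I, ∀ b ∈ I, ¬ G.Adj a b) :
    ((properOff G q J).card : ℝ)
      = ∑ φ ∈ properOff G q I, ∏ u ∈ I \ J, ((freeColors G φ u).card : ℝ) / q := by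
  have key := sum_mul_prod_indicator_eq hq (I \ J)
    (fun φ => if φ ∈ properOff G q I then (1 : ℝ) else 0) (fun u φ => freeColors G φ u)
    (fun φ ψ h => by
      simp only [mem_properOff_congr G I (fun w hw _ => h w (by simp [hw]))])
    (fun u hu φ ψ h => freeColors_congr G u fun w hw => h w fun hw' =>
      hI u (Finset.mem_sdiff.1 hu).1 w (Finset.mem_sdiff.1 hw').1 hw)
  simp only [ite_mul, one_mul, zero_mul] at key
  rw [← Finset.sum_filter, ← Finset.sum_filter, Finset.filter_univ_mem] at key
  rw [← key]
  suffices hset : properOff G q J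
      = (properOff G q I).filter fun φ => ∀ u ∈ I \ J, φ u ∈ freeColors G φ u by
    rw [hset, Finset.card_filter, Nat.cast_sum]
    refine Finset.sum_congr rfl fun φ _ => ?_
    rw [Finset.prod_boole]
    split_ifs <;> simp
  ext φ
  simp only [properOff, freeColors, Finset.mem_filter, Finset.mem_univ, true_and,
    Finset.mem_sdiff, and_imp]
  constructor
  · intro h
    exact ⟨fun a b ha hb => h a b (fun h' => ha (hJ h')) (fun h' => hb (hJ h')),
      fun u hu hu' w hw => h w u (fun h' => hI u hu w (hJ h') hw) hu' hw.symm⟩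
  · rintro ⟨h1, h2⟩ a b ha hb hab
    by_cases haI : a ∈ I
    · exact (h2 a haI ha b hab).symm
    by_cases hbI : b ∈ I
    · exact h2 b hbI hb a hab.symm
    exact h1 a b haI hbI hab

/-! ### Isolating one vertex -/

theorem properOff_deleteIncidenceSet (G : SimpleGraph V) (v : V) (I : Finset V) :
    properOff (G.deleteIncidenceSet v) q I = properOff G q (insert v I) := by
  ext φ
  simp only [properOff, Finset.mem_filter, Finset.mem_univ, true_and, Finset.mem_insert, not_or,
    SimpleGraph.deleteIncidenceSet_adj]
  exact ⟨fun h a b ha hb hab => h a b ha.2 hb.2 ⟨hab, ha.1, hb.1⟩,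
    fun h a b ha hb hab => h a b ⟨hab.2.1, ha⟩ ⟨hab.2.2, hb⟩ hab.1⟩

theorem properOff_insert_of_neighbor_subset (G : SimpleGraph V) {v : V} {I : Finset V}
    (h : ∀ w, G.Adj v w → w ∈ I) : properOff G q (insert v I) = properOff G q I := by
  ext φ
  simp only [properOff, Finset.mem_filter, Finset.mem_univ, true_and, Finset.mem_insert, not_or]
  refine ⟨fun hφ a b ha hb hab => hφ a b ⟨?_, ha⟩ ⟨?_, hb⟩ hab,
    fun hφ a b ha hb hab => hφ a b ha.2 hb.2 hab⟩
  · rintro rfl; exact hb (h _ hab)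
  · rintro rfl; exact ha (h _ hab.symm)

theorem freeColors_eq_erase (G : SimpleGraph V) {u v : V} (h : G.Adj u v) (φ : V → Fin q) :
    freeColors G φ u = (freeColors (G.deleteIncidenceSet v) φ u).erase (φ v) := by
  ext c
  simp only [freeColors, Finset.mem_filter, Finset.mem_univ, true_and, Finset.mem_erase,
    SimpleGraph.deleteIncidenceSet_adj]
  refine ⟨fun hc => ⟨(hc v h).symm, fun w hw => hc w hw.1⟩, fun hc w hw => ?_⟩
  by_cases hwv : w = v
  · rw [hwv]; exact hc.1.symm
  · exact hc.2 w ⟨hw, h.ne, hwv⟩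

/-- The edge `uv` is not counted against `u` once `v` is isolated, so `u` keeps two colors, not just
one. This is what bounds the loss factor `1 - 1 / #L` away from `0`. -/
theorem two_le_card_freeColors (G : SimpleGraph V) {u v : V} (h : G.Adj u v)
    (hd : G.degree u < q) (φ : V → Fin q) :
    2 ≤ (freeColors (G.deleteIncidenceSet v) φ u).card := by
  have hsub : (freeColors (G.deleteIncidenceSet v) φ u)ᶜ
      ⊆ ((G.neighborFinset u).erase v).image φ := by
    intro c hc
    simp only [freeColors, SimpleGraph.deleteIncidenceSet_adj, Finset.mem_compl,
      Finset.mem_filter, Finset.mem_univ, true_and, not_forall, not_not] at hc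
    obtain ⟨w, hw, rfl⟩ := hc
    exact Finset.mem_image_of_mem _ (by simp [hw.1, hw.2.2])
  have h1 := (Finset.card_le_card hsub).trans Finset.card_image_le
  rw [Finset.card_compl, Fintype.card_fin, Finset.card_erase_of_mem (by simpa using h),
    G.card_neighborFinset_eq_degree] at h1
  have : 0 < G.degree u := (G.degree_pos_iff_exists_adj u).2 ⟨v, h⟩
  omega

/-! ### Jensen's inequality and the cost of isolating a vertex -/

/-- Jensen's inequality for `x ↦ exp (-x)` with unnormalized weights `W`, in a form that also holds
when all weights vanish. -/
theorem exp_neg_mul_sum_le {ι : Type*} (s : Finset ι) (W X : ι → ℝ) (μ : ℝ)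
    (hW : ∀ i ∈ s, 0 ≤ W i) (h : ∑ i ∈ s, W i * X i ≤ μ * ∑ i ∈ s, W i) :
    (∑ i ∈ s, W i) * Real.exp (-μ) ≤ ∑ i ∈ s, W i * Real.exp (-X i) := by
  have h1 : ∀ i ∈ s, Real.exp (-μ) * (W i * (1 + μ) - W i * X i) ≤ W i * Real.exp (-X i) := by
    intro i hi
    have h2 : Real.exp (-X i) = Real.exp (-μ) * Real.exp (μ - X i) := by
      rw [← Real.exp_add]; congr 1; ring
    -- the tangent line of the exponential at the mean
    have h3 : 1 + μ - X i ≤ Real.exp (μ - X i) := by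
      linarith [Real.add_one_le_exp (μ - X i)]
    rw [h2]
    calc _ = Real.exp (-μ) * W i * (1 + μ - X i) := by ring
      _ ≤ Real.exp (-μ) * W i * Real.exp (μ - X i) :=
        mul_le_mul_of_nonneg_left h3 (mul_nonneg (Real.exp_pos _).le (hW i hi))
      _ = _ := by ring
  refine le_trans ?_ (Finset.sum_le_sum h1)
  rw [← Finset.mul_sum, Finset.sum_sub_distrib, ← Finset.sum_mul, mul_comm]
  refine mul_le_mul_of_nonneg_left ?_ (Real.exp_pos _).le
  linarith

theorem exp_neg_le_one_sub_inv {l : ℝ} (hl : 2 ≤ l) :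
    Real.exp (-(1 / l * (1 + 2 / l))) ≤ 1 - 1 / l := by
  have hx : 1 / l ≤ 1 / 2 := by gcongr
  have hx0 : 0 < 1 / l := by positivity
  have : 2 / l = 2 * (1 / l) := by ring
  rw [this]
  generalize 1 / l = x at *
  have h1 : 0 < 1 - x := by linarith
  rw [Real.exp_neg, inv_le_comm₀ (Real.exp_pos _) h1]
  refine le_trans ?_ (Real.add_one_le_exp _)
  rw [inv_le_iff_one_le_mul₀ h1]
  nlinarith [mul_pos hx0 hx0]

theorem card_mul_exp_le_card_erase (L : Finset (Fin q)) (hL : 2 ≤ L.card) (c : Fin q) :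
    (L.card : ℝ) * Real.exp (-(if c ∈ L then 1 / (L.card : ℝ) * (1 + 2 / L.card) else 0))
      ≤ ((L.erase c).card : ℝ) := by
  have hL' : (2 : ℝ) ≤ L.card := by exact_mod_cast hL
  split_ifs with hc
  · rw [Finset.card_erase_of_mem hc, Nat.cast_sub (by omega)]
    refine (mul_le_mul_of_nonneg_left (exp_neg_le_one_sub_inv hL') (by positivity)).trans_eq ?_
    field_simp
    simp
  · simp [Finset.erase_eq_of_notMem hc]

theorem degree_lt_of_le {G H : SimpleGraph V} (hle : H ≤ G) (hd : ∀ u, G.degree u < q) (u : V) :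
    H.degree u < q :=
  (SimpleGraph.degree_le_of_le hle).trans_lt (hd u)

/-- Comparison of `G` with the graph `H` in which `v` is isolated. A random coloring of `H` is a
coloring of `G` if the color of `v` avoids those of its neighbors. Conditionally on the colors off
`N(v)`, this has probability `∏ (1 - 1 / #L u)` over the neighbors `u` whose list `L u` of free
colors contains the color of `v`. Jensen's inequality moves the expectation into the exponent, and
averaging over the color of `v` replaces the indicator of `φ v ∈ L u` by `#(L u) / q`. -/
theorem card_mul_exp_le_card_properOff (hq : 0 < q) (G : SimpleGraph V) (v : V)
    (hI : ∀ a ∈ G.neighborFinset v, ∀ b ∈ G.neighborFinset v, ¬ G.Adj a b)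
    (hL : ∀ u ∈ G.neighborFinset v, G.degree u < q) (μ : ℝ)
    (hμ : ∑ φ ∈ properOff (G.deleteIncidenceSet v) q (G.neighborFinset v),
        (∏ u ∈ G.neighborFinset v, ((freeColors (G.deleteIncidenceSet v) φ u).card : ℝ) / q) *
          ∑ u ∈ G.neighborFinset v,
            (1 + 2 / ((freeColors (G.deleteIncidenceSet v) φ u).card : ℝ)) / q
      ≤ μ * ((properOff (G.deleteIncidenceSet v) q ∅).card : ℝ)) :
    ((properOff (G.deleteIncidenceSet v) q ∅).card : ℝ) * Real.exp (-μ)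
      ≤ ((properOff G q ∅).card : ℝ) := by
  set H := G.deleteIncidenceSet v with hH
  set I := G.neighborFinset v
  have hadj : ∀ u ∈ I, G.Adj u v := fun u hu => ((G.mem_neighborFinset v u).1 hu).symm
  have hHG : ∀ {a b}, H.Adj a b → G.Adj a b ∧ a ≠ v ∧ b ≠ v := by
    intro a b hab
    rwa [hH, SimpleGraph.deleteIncidenceSet_adj] at hab
  have hHI : ∀ a ∈ I, ∀ b ∈ I, ¬ H.Adj a b := fun a ha b hb hab => hI a ha b hb (hHG hab).1
  have hP : properOff G q I = properOff H q I := by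
    rw [hH, properOff_deleteIncidenceSet, properOff_insert_of_neighbor_subset]
    exact fun w hw => (G.mem_neighborFinset v w).2 hw
  have hLH : ∀ φ : V → Fin q, ∀ u ∈ I, 2 ≤ (freeColors H φ u).card := fun φ u hu =>
    two_le_card_freeColors G (hadj u hu) (hL u hu) φ
  have herase : ∀ φ : V → Fin q, ∀ u ∈ I, freeColors G φ u = (freeColors H φ u).erase (φ v) :=
    fun φ u hu => freeColors_eq_erase G (hadj u hu) φ
  clear_value H I
  set W : (V → Fin q) → ℝ := fun φ => ∏ u ∈ I, ((freeColors H φ u).card : ℝ) / q with hW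
  have hNH : ((properOff H q ∅).card : ℝ) = ∑ φ ∈ properOff H q I, W φ := by
    rw [card_properOff_eq_sum hq H (Finset.empty_subset I) hHI, Finset.sdiff_empty]
  set g : (V → Fin q) → V → ℝ := fun φ u =>
    1 / ((freeColors H φ u).card : ℝ) * (1 + 2 / ((freeColors H φ u).card : ℝ)) with hg
  have hNG : ∑ φ ∈ properOff H q I, W φ *
        Real.exp (-∑ u ∈ I, if φ v ∈ freeColors H φ u then g φ u else 0)
      ≤ ((properOff G q ∅).card : ℝ) := by
    rw [card_properOff_eq_sum hq G (Finset.empty_subset I) hI, Finset.sdiff_empty, hP]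
    refine Finset.sum_le_sum fun φ _ => ?_
    rw [← Finset.sum_neg_distrib, Real.exp_sum, hW, ← Finset.prod_mul_distrib]
    refine Finset.prod_le_prod (fun u _ => by positivity) fun u hu => ?_
    rw [herase φ u hu, div_mul_eq_mul_div]
    gcongr
    exact card_mul_exp_le_card_erase _ (hLH φ u hu) _
  refine le_trans ?_ hNG
  rw [hNH]
  refine exp_neg_mul_sum_le _ _ _ _ (fun φ _ => by positivity) ?_
  rw [← hNH]
  refine le_trans (le_of_eq ?_) hμ
  -- Only the indicators of `φ v ∈ L u` involve the color of `v`, because `v` is isolated in `H`;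
  -- that color is resampled.
  simp_rw [Finset.mul_sum]
  rw [Finset.sum_comm, Finset.sum_comm (s := properOff H q I)]
  refine Finset.sum_congr rfl fun u hu => ?_
  have hinv : ∀ φ ψ : V → Fin q, (∀ w ∉ ({v} : Finset V), φ w = ψ w) →
      ∀ x, freeColors H φ x = freeColors H ψ x := fun φ ψ h x =>
    freeColors_congr H x fun w hw => h w (by simpa using (hHG hw).2.2)
  have key := sum_mul_prod_indicator_eq hq {v}
    (fun φ => if φ ∈ properOff H q I then W φ * g φ u else 0) (fun _ φ => freeColors H φ u)
    (fun φ ψ h => by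
      have h1 := mem_properOff_congr H I (φ := φ) (ψ := ψ) fun w _ ⟨x, hx⟩ =>
        h w (by simpa using (hHG hx).2.1)
      simp only [h1, hW, hg, hinv φ ψ h])
    (fun _ _ φ ψ h => hinv φ ψ h u)
  simp only [Finset.prod_singleton, ite_mul, zero_mul, ← Finset.sum_filter,
    Finset.filter_univ_mem] at key
  simp only [mul_ite, mul_zero, mul_one] at key ⊢
  rw [key]
  refine Finset.sum_congr rfl fun φ _ => ?_
  have : ((freeColors H φ u).card : ℝ) ≠ 0 := by
    have := hLH φ u hu
    positivity
  simp only [hg, hW]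
  field_simp

/-- The crude bound: since `#(L u) ≥ 2`, each of the fewer than `q` neighbors of `v` contributes at
most `2 / q` to the exponent. -/
theorem card_properOff_deleteIncidenceSet_le (hq : 0 < q) (G : SimpleGraph V) (v : V)
    (hI : ∀ a ∈ G.neighborFinset v, ∀ b ∈ G.neighborFinset v, ¬ G.Adj a b)
    (hd : ∀ u, G.degree u < q) :
    ((properOff (G.deleteIncidenceSet v) q ∅).card : ℝ)
      ≤ Real.exp 2 * ((properOff G q ∅).card : ℝ) := by
  have h := card_mul_exp_le_card_properOff hq G v hI (fun u _ => hd u) 2 ?_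
  · rwa [Real.exp_neg, ← div_eq_mul_inv, div_le_iff₀ (Real.exp_pos _), mul_comm _ (Real.exp 2)] at h
  · rw [card_properOff_eq_sum hq (G.deleteIncidenceSet v)
      (Finset.empty_subset (G.neighborFinset v))
      (fun a ha b hb hab => hI a ha b hb (G.deleteIncidenceSet_le v hab)), Finset.sdiff_empty,
      mul_comm, Finset.sum_mul]
    refine Finset.sum_le_sum fun φ _ => mul_le_mul_of_nonneg_left ?_ (by positivity)
    have hq' : (0 : ℝ) < q := by exact_mod_cast hq
    calc _ ≤ ∑ u ∈ G.neighborFinset v, 2 / (q : ℝ) := by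
          refine Finset.sum_le_sum fun u hu => ?_
          have h2 := two_le_card_freeColors G
            (SimpleGraph.Adj.symm (by simpa using hu)) (hd u) φ
          have h2' : (2 : ℝ) ≤ (freeColors (G.deleteIncidenceSet v) φ u).card := by
            exact_mod_cast h2
          gcongr
          have : 2 / ((freeColors (G.deleteIncidenceSet v) φ u).card : ℝ) ≤ 1 := by
            rw [div_le_one (by linarith)]; exact h2'
          linarith
      _ = (G.degree v : ℝ) / q * 2 := by
          rw [Finset.sum_const, G.card_neighborFinset_eq_degree, nsmul_eq_mul]; ring
      _ ≤ 1 * 2 := by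
          gcongr
          rw [div_le_one hq']
          exact_mod_cast (hd v).le
      _ = 2 := one_mul _

/-- The sharp bound: each edge at `v` costs a factor `exp (-(1 + O(1 / q)) / q)`. The error term is
governed by the mean of `1 / #(L u)` over the colorings of `H`. In them a list occurs with
probability proportional to its size, so this mean equals `c(H - u) / c(H)`, which the crude
bound, applied at `u`, shows to be `O(1 / q)`. -/
theorem card_properOff_deleteIncidenceSet_mul_exp_le (hq : 0 < q) (G : SimpleGraph V) (v : V)
    (hG : ∀ a b c, G.Adj a b → G.Adj a c → ¬ G.Adj b c) (hd : ∀ u, G.degree u < q) :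
    ((properOff (G.deleteIncidenceSet v) q ∅).card : ℝ) *
        Real.exp (-(G.degree v * ((1 + 2 * Real.exp 2 / q) / q)))
      ≤ ((properOff G q ∅).card : ℝ) := by
  have hq' : (0 : ℝ) < q := by exact_mod_cast hq
  have hI : ∀ a ∈ G.neighborFinset v, ∀ b ∈ G.neighborFinset v, ¬ G.Adj a b := fun a ha b hb =>
    hG v a b (by simpa using ha) (by simpa using hb)
  refine card_mul_exp_le_card_properOff hq G v hI (fun u _ => hd u) _ ?_
  set H := G.deleteIncidenceSet v with hH
  set I := G.neighborFinset v
  have hLH : ∀ φ : V → Fin q, ∀ u ∈ I, 2 ≤ (freeColors H φ u).card := fun φ u hu =>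
    two_le_card_freeColors G ((G.mem_neighborFinset v u).1 hu).symm (hd u) φ
  have hcardI : I.card = G.degree v := G.card_neighborFinset_eq_degree v
  have hle : H ≤ G := G.deleteIncidenceSet_le v
  have hHI : ∀ a ∈ I, ∀ b ∈ I, ¬ H.Adj a b := fun a ha b hb hab => hI a ha b hb (hle hab)
  clear_value H I
  have hN : ((properOff H q ∅).card : ℝ)
      = ∑ φ ∈ properOff H q I, ∏ u ∈ I, ((freeColors H φ u).card : ℝ) / q := by
    rw [card_properOff_eq_sum hq H (Finset.empty_subset I) hHI, Finset.sdiff_empty]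
  have hterm : ∀ u ∈ I, ∑ φ ∈ properOff H q I,
      (∏ w ∈ I, ((freeColors H φ w).card : ℝ) / q) *
        ((1 + 2 / ((freeColors H φ u).card : ℝ)) / q)
      ≤ (1 + 2 * Real.exp 2 / q) / q * ((properOff H q ∅).card : ℝ) := by
    intro u hu
    have hdel : ((properOff H q {u}).card : ℝ) ≤ Real.exp 2 * ((properOff H q ∅).card : ℝ) := by
      have := card_properOff_deleteIncidenceSet_le hq H u
        (fun a ha b hb hab => hG u a b (hle (by simpa using ha)) (hle (by simpa using hb))
          (hle hab))
        (degree_lt_of_le hle hd)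
      rwa [properOff_deleteIncidenceSet, insert_empty_eq] at this
    have hsum : ∀ φ ∈ properOff H q I, (∏ w ∈ I, ((freeColors H φ w).card : ℝ) / q) *
        ((1 + 2 / ((freeColors H φ u).card : ℝ)) / q)
        = (∏ w ∈ I, ((freeColors H φ w).card : ℝ) / q) / q
          + (∏ w ∈ I \ {u}, ((freeColors H φ w).card : ℝ) / q) * (2 / q / q) := by
      intro φ _
      have h2 : ((freeColors H φ u).card : ℝ) ≠ 0 := by
        have := hLH φ u hu
        positivity
      -- the factor `#(L u)` of the weight cancels the denominator
      rw [Finset.prod_eq_mul_prod_sdiff_singleton_of_mem hu]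
      field_simp
    rw [Finset.sum_congr rfl hsum, Finset.sum_add_distrib, ← Finset.sum_div, ← Finset.sum_mul,
      ← hN, ← card_properOff_eq_sum hq H (Finset.singleton_subset_iff.2 hu) hHI]
    calc _ ≤ ((properOff H q ∅).card : ℝ) / q
          + Real.exp 2 * ((properOff H q ∅).card : ℝ) * (2 / q / q) := by gcongr
      _ = _ := by ring
  simp_rw [Finset.mul_sum]
  rw [Finset.sum_comm]
  refine (Finset.sum_le_sum hterm).trans_eq ?_
  rw [Finset.sum_const, hcardI, nsmul_eq_mul]
  ring

/-! ### The lower bound for triangle-free graphs -/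

theorem pow_mul_exp_le_card_properOff (hq : 0 < q) (G : SimpleGraph V)
    (hG : ∀ a b c, G.Adj a b → G.Adj a c → ¬ G.Adj b c) (hd : ∀ u, G.degree u < q) :
    (q : ℝ) ^ Fintype.card V *
        Real.exp (-(G.edgeFinset.card * ((1 + 2 * Real.exp 2 / q) / q)))
      ≤ ((properOff G q ∅).card : ℝ) := by
  induction hm : G.edgeFinset.card using Nat.strong_induction_on generalizing G with
  | _ m ih =>
  subst hm
  by_cases h : ∃ v w, G.Adj v w
  · obtain ⟨v, w, hvw⟩ := h
    obtain ⟨H, hH⟩ : ∃ H, H = G.deleteIncidenceSet v := ⟨_, rfl⟩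
    have hle : H ≤ G := hH ▸ G.deleteIncidenceSet_le v
    have hdv : 0 < G.degree v := (G.degree_pos_iff_exists_adj v).2 ⟨w, hvw⟩
    have hcard : H.edgeFinset.card = G.edgeFinset.card - G.degree v := by
      rw [← G.card_edgeFinset_deleteIncidenceSet v]
      subst hH
      congr!
    have hdle : G.degree v ≤ G.edgeFinset.card := G.degree_le_card_edgeFinset v
    have h1 := ih _ (by omega) H
      (fun a b c hab hac hbc => hG a b c (hle hab) (hle hac) (hle hbc))
      (degree_lt_of_le hle hd) rfl
    have h2 := card_properOff_deleteIncidenceSet_mul_exp_le hq G v hG hd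
    rw [← hH] at h2
    refine le_trans ?_ ((mul_le_mul_of_nonneg_right h1 (Real.exp_pos _).le).trans h2)
    rw [mul_assoc, ← Real.exp_add, hcard, Nat.cast_sub hdle]
    refine le_of_eq ?_
    congr 2
    ring
  · push Not at h
    have hbot : G.edgeFinset.card = 0 := by
      rw [Finset.card_eq_zero, SimpleGraph.edgeFinset_eq_empty]
      ext a b
      simp [h]
    have huniv : properOff G q ∅ = Finset.univ := by
      ext φ
      simp [properOff, h]
    simp [hbot, huniv]

theorem numColorings_eq_card_properOff (G : SimpleGraph V) (q : ℕ) :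
    numColorings G q = (properOff G q ∅).card := by
  rw [numColorings, ← Nat.card_eq_finsetCard]
  refine Nat.card_congr
    { toFun := fun C => ⟨C, by
        simpa [properOff] using fun a b hab => C.valid hab⟩
      invFun := fun φ => SimpleGraph.Coloring.mk φ.1 fun {a b} hab => by
        have := φ.2
        simp only [properOff, Finset.mem_filter] at this
        exact this.2 a b (by simp) (by simp) hab
      left_inv := fun C => rfl
      right_inv := fun φ => rfl }

/-- A graph of maximum degree at most `Δ` has at most `n * Δ / 2` edges, so the edges together cost
a factor of at most `exp (1 / 2 + O(1 / Δ))` per vertex. -/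
theorem max_pow_le_numColorings (Δ : ℕ) (G : SimpleGraph V) (hG : G.CliqueFree 3)
    (hd : ∀ u, G.degree u ≤ Δ) :
    (max 0 ((Δ : ℝ) / Real.sqrt (Real.exp 1) - Real.exp 2)) ^ Fintype.card V
      ≤ (numColorings G (Δ + 1) : ℝ) := by
  have hG' : ∀ a b c, G.Adj a b → G.Adj a c → ¬ G.Adj b c := fun a b c hab hac hbc =>
    hG {a, b, c} (SimpleGraph.is3Clique_triple_iff.2 ⟨hab, hac, hbc⟩)
  rw [numColorings_eq_card_properOff]
  refine le_trans ?_ (pow_mul_exp_le_card_properOff Δ.succ_pos G hG'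
    fun u => Nat.lt_succ_of_le (hd u))
  have hm : (G.edgeFinset.card : ℝ) ≤ Fintype.card V * (Δ / 2) := by
    have h1 := G.sum_degrees_eq_twice_card_edges
    have h2 : ∑ v, G.degree v ≤ Fintype.card V * Δ := by
      simpa using Finset.sum_le_sum fun v (_ : v ∈ Finset.univ) => hd v
    have h3 : (2 : ℝ) * G.edgeFinset.card ≤ Fintype.card V * Δ := by
      rw [h1] at h2; exact_mod_cast h2
    linarith
  set q : ℝ := ((Δ + 1 : ℕ) : ℝ) with hq
  have hqΔ : q = Δ + 1 := by simp [hq]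
  have hq0 : 0 < q := by positivity
  have hexp : Fintype.card V * (-(1 / 2) - Real.exp 2 / q)
      ≤ -(G.edgeFinset.card * ((1 + 2 * Real.exp 2 / q) / q)) := by
    have : (G.edgeFinset.card : ℝ) * ((1 + 2 * Real.exp 2 / q) / q)
        ≤ Fintype.card V * (q / 2) * ((1 + 2 * Real.exp 2 / q) / q) := by
      gcongr
      refine hm.trans ?_
      gcongr
      linarith
    have h2 : (Fintype.card V : ℝ) * (q / 2) * ((1 + 2 * Real.exp 2 / q) / q)
        = Fintype.card V * (1 / 2 + Real.exp 2 / q) := by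
      field_simp
    linarith
  have hs : Real.sqrt (Real.exp 1) = Real.exp (1 / 2) := by
    rw [Real.exp_half]
  calc _ ≤ (q * Real.exp (-(1 / 2) - Real.exp 2 / q)) ^ Fintype.card V := by
        refine pow_le_pow_left₀ (le_max_left _ _) (max_le (by positivity) ?_) _
        rw [sub_eq_add_neg (-(1 / 2) : ℝ), Real.exp_add, hs, div_eq_mul_inv, ← Real.exp_neg]
        have h1 : Real.exp (-(1 / 2)) ≤ 1 := Real.exp_le_one_iff.2 (by norm_num)
        have h2 : 1 - Real.exp 2 / q ≤ Real.exp (-(Real.exp 2 / q)) := by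
          linarith [Real.add_one_le_exp (-(Real.exp 2 / q))]
        have h3 : q * Real.exp (-(1 / 2)) * (1 - Real.exp 2 / q)
            ≤ q * Real.exp (-(1 / 2)) * Real.exp (-(Real.exp 2 / q)) :=
          mul_le_mul_of_nonneg_left h2 (by positivity)
        have h4 : q * Real.exp (-(1 / 2)) * (1 - Real.exp 2 / q)
            = q * Real.exp (-(1 / 2)) - Real.exp 2 * Real.exp (-(1 / 2)) := by
          field_simp
        have h5 : Real.exp 2 * Real.exp (-(1 / 2)) ≤ Real.exp 2 * 1 := by gcongr
        have h6 : (Δ : ℝ) * Real.exp (-(1 / 2)) ≤ q * Real.exp (-(1 / 2)) := by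
          gcongr; linarith
        linarith
    _ = q ^ Fintype.card V * Real.exp (Fintype.card V * (-(1 / 2) - Real.exp 2 / q)) := by
        rw [mul_pow, ← Real.exp_nat_mul]
    _ ≤ _ := by gcongr

end

/-! ### Disjoint unions of cliques -/

theorem numColorings_disjointCliques (k s : ℕ) :
    numColorings (disjointCliques k s) s = (Nat.factorial s) ^ k := by
  have e : (disjointCliques k s).Coloring (Fin s) ≃ (Fin k → (Fin s ↪ Fin s)) :=
    { toFun := fun C i => ⟨fun a => C (i, a), fun a b hab => by
        by_contra hne
        exact C.valid (v := (i, a)) (w := (i, b)) ⟨rfl, hne⟩ hab⟩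
      invFun := fun f => SimpleGraph.Coloring.mk (fun x => f x.1 x.2) fun {x y} hxy heq => by
        obtain ⟨h1, h2⟩ := hxy
        simp only [h1] at heq
        exact h2 ((f y.1).injective heq)
      left_inv := fun C => rfl
      right_inv := fun f => rfl }
  rw [numColorings, Nat.card_congr e, Nat.card_eq_fintype_card]
  simp [Fintype.card_embedding_eq, Nat.descFactorial_self]

/-- The `n`-th root of Stirling's formula: the square-root factor and the constant disappear. -/
theorem tendsto_factorial_rpow_div :
    Tendsto (fun n : ℕ => (n.factorial : ℝ) ^ (1 / (n : ℝ)) / n) atTop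
      (nhds (1 / Real.exp 1)) := by
  have hinv : Tendsto (fun n : ℕ => 1 / (n : ℝ)) atTop (nhds 0) :=
    tendsto_one_div_atTop_nhds_zero_nat
  have h1 : Tendsto (fun n : ℕ => Stirling.stirlingSeq n ^ (1 / (n : ℝ))) atTop (nhds 1) := by
    have := Stirling.tendsto_stirlingSeq_sqrt_pi.rpow hinv (Or.inl (by positivity))
    rwa [Real.rpow_zero] at this
  have h2 : Tendsto (fun n : ℕ => (2 * (n : ℝ)) ^ (1 / (2 * (n : ℝ)))) atTop (nhds 1) :=
    tendsto_rpow_div.comp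
      (tendsto_natCast_atTop_atTop.const_mul_atTop (two_pos : (0 : ℝ) < 2))
  have h3 := (h1.mul h2).mul_const (1 / Real.exp 1)
  rw [one_mul, one_mul] at h3
  refine h3.congr' ?_
  filter_upwards [eventually_gt_atTop 0] with n hn
  have hn' : (0 : ℝ) < n := by exact_mod_cast hn
  have hfac : (n.factorial : ℝ)
      = Stirling.stirlingSeq n * (Real.sqrt (2 * n) * (n / Real.exp 1) ^ n) := by
    rw [Stirling.stirlingSeq, div_mul_cancel₀]
    positivity
  have hs : 0 ≤ Stirling.stirlingSeq n := by
    rw [Stirling.stirlingSeq]; positivity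
  rw [hfac, Real.mul_rpow hs (by positivity),
    Real.mul_rpow (Real.sqrt_nonneg _) (by positivity), Real.sqrt_eq_rpow,
    ← Real.rpow_mul (by positivity), ← Real.rpow_natCast,
    ← Real.rpow_mul (by positivity), mul_one_div_cancel hn'.ne', Real.rpow_one]
  have : (1 : ℝ) / 2 * (1 / n) = 1 / (2 * n) := by ring
  rw [this]
  field_simp

theorem factorial_rpow_sub_isLittleO :
    (fun Δ : ℕ => ((Δ + 1).factorial : ℝ) ^ (1 / ((Δ + 1 : ℕ) : ℝ)) - Δ / Real.exp 1)
      =o[atTop] (fun Δ : ℕ => (Δ : ℝ)) := by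
  rw [isLittleO_iff_tendsto' (by
    filter_upwards [eventually_ne_atTop 0] with n hn h
    exact absurd (by exact_mod_cast h) hn)]
  have h1 := tendsto_factorial_rpow_div.comp (tendsto_add_atTop_nat 1)
  have h2 : Tendsto (fun n : ℕ => ((n + 1 : ℕ) : ℝ) / n) atTop (nhds 1) := by
    have := (tendsto_one_div_atTop_nhds_zero_nat (𝕜 := ℝ)).const_add 1
    rw [add_zero] at this
    refine this.congr' ?_
    filter_upwards [eventually_ne_atTop 0] with n hn
    have : (n : ℝ) ≠ 0 := by exact_mod_cast hn
    push_cast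
    field_simp
  have h3 := (h1.mul h2).sub_const (1 / Real.exp 1)
  rw [mul_one, sub_self] at h3
  refine h3.congr' ?_
  filter_upwards [eventually_ne_atTop 0] with n hn
  have : (n : ℝ) ≠ 0 := by exact_mod_cast hn
  have : ((n + 1 : ℕ) : ℝ) ≠ 0 := by positivity
  simp only [Function.comp_apply]
  field_simp

theorem degree_disjointCliques (k s : ℕ) (x : Fin k × Fin s) :
    (disjointCliques k s).degree x = s - 1 := by
  have : (disjointCliques k s).neighborFinset x
      = (Finset.univ.erase x.2).map ⟨fun a => (x.1, a), fun a b h => (Prod.mk.inj h).2⟩ := by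
    ext ⟨i, a⟩
    rw [SimpleGraph.mem_neighborFinset]
    simp only [disjointCliques, Finset.mem_map, Finset.mem_erase, Finset.mem_univ, and_true]
    constructor
    · rintro ⟨h1, h2⟩
      obtain rfl : x.1 = i := h1
      exact ⟨a, h2.symm, rfl⟩
    · rintro ⟨b, h2, h⟩
      obtain ⟨rfl, rfl⟩ := Prod.mk.inj (show (x.1, b) = (i, a) from h)
      exact ⟨rfl, h2.symm⟩
  rw [← SimpleGraph.card_neighborFinset_eq_degree, this, Finset.card_map,
    Finset.card_erase_of_mem (Finset.mem_univ _), Finset.card_univ, Fintype.card_fin]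

theorem maxDegree_disjointCliques {k s : ℕ} (hk : 0 < k) (hs : 0 < s) :
    (disjointCliques k s).maxDegree = s - 1 := by
  refine le_antisymm
    (SimpleGraph.maxDegree_le_of_forall_degree_le _ _ fun x => (degree_disjointCliques k s x).le) ?_
  rw [← degree_disjointCliques k s (⟨0, hk⟩, ⟨0, hs⟩)]
  exact SimpleGraph.degree_le_maxDegree _ _

theorem not_cliqueFree_disjointCliques {k s : ℕ} (hk : 0 < k) (hs : 3 ≤ s) :
    ¬ (disjointCliques k s).CliqueFree 3 := by
  intro h
  refine h {(⟨0, hk⟩, ⟨0, by omega⟩), (⟨0, hk⟩, ⟨1, by omega⟩), (⟨0, hk⟩, ⟨2, by omega⟩)}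
    (SimpleGraph.is3Clique_triple_iff.2 ?_)
  simp [disjointCliques]

theorem factorial_pow_eq (Δ k : ℕ) :
    (((Δ + 1).factorial ^ k : ℕ) : ℝ) = (Δ / Real.exp 1 +
      (((Δ + 1).factorial : ℝ) ^ (1 / ((Δ + 1 : ℕ) : ℝ)) - Δ / Real.exp 1)) ^ (k * (Δ + 1)) := by
  rw [add_sub_cancel, mul_comm k, pow_mul, one_div, Real.rpow_inv_natCast_pow (by positivity)
    Δ.succ_ne_zero, Nat.cast_pow]

theorem eventually_add_lt_div_sqrt_sub {g : ℕ → ℝ} (hg : g =o[atTop] (fun Δ : ℕ => (Δ : ℝ)))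
    (C : ℝ) :
    ∀ᶠ Δ : ℕ in atTop, (Δ : ℝ) / Real.exp 1 + g Δ < Δ / Real.sqrt (Real.exp 1) - C := by
  have hs : Real.sqrt (Real.exp 1) < Real.exp 1 :=
    by
    rw [← Real.exp_half]; exact Real.exp_lt_exp.2 (by norm_num)
  have hs0 : 0 < Real.sqrt (Real.exp 1) := Real.sqrt_pos.2 (Real.exp_pos _)
  set δ := 1 / Real.sqrt (Real.exp 1) - 1 / Real.exp 1 with hδ
  have hδ0 : 0 < δ := sub_pos.2 (one_div_lt_one_div_of_lt hs0 hs)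
  have h1 := hg.bound (half_pos hδ0)
  have h2 : ∀ᶠ Δ : ℕ in atTop, C < δ / 2 * (Δ : ℝ) :=
    (tendsto_natCast_atTop_atTop.const_mul_atTop (half_pos hδ0)).eventually_gt_atTop C
  filter_upwards [h1, h2] with Δ hΔ1 hΔ2
  rw [Real.norm_natCast] at hΔ1
  have h3 := (le_abs_self _).trans hΔ1
  have h4 : (Δ : ℝ) / Real.sqrt (Real.exp 1) - Δ / Real.exp 1 = δ * Δ := by rw [hδ]; ring
  linarith

theorem mainTheorem8 :
    -- the lower bound for triangle-free graphs, with an absolute constant `C`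
    (∃ C : ℝ, ∀ (Δ : ℕ) (V : Type*) [Fintype V] (G : SimpleGraph V) [DecidableRel G.Adj],
      G.CliqueFree 3 → G.maxDegree ≤ Δ →
        (max 0 ((Δ : ℝ) / Real.sqrt (Real.exp 1) - C)) ^ Fintype.card V
          ≤ (numColorings G (Δ + 1) : ℝ)) ∧
    -- disjoint unions of cliques on `Δ + 1` vertices: the exact number of colorings,
    (∀ Δ k : ℕ, numColorings (disjointCliques k (Δ + 1)) (Δ + 1) = (Nat.factorial (Δ + 1)) ^ k) ∧
    -- its asymptotic form `(Δ / e + o(Δ)) ^ n`,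
    (∃ g : ℕ → ℝ, g =o[atTop] (fun Δ : ℕ => (Δ : ℝ)) ∧
      ∀ Δ k : ℕ, (numColorings (disjointCliques k (Δ + 1)) (Δ + 1) : ℝ)
        = ((Δ : ℝ) / Real.exp 1 + g Δ) ^ (k * (Δ + 1))) ∧
    -- and the failure of the lower bound, whatever the constant `C`
    (∀ C : ℝ, ∀ᶠ Δ : ℕ in atTop, ∀ k : ℕ, 1 ≤ k →
      (disjointCliques k (Δ + 1)).maxDegree = Δ ∧
      ¬ (disjointCliques k (Δ + 1)).CliqueFree 3 ∧
      (numColorings (disjointCliques k (Δ + 1)) (Δ + 1) : ℝ)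
        < (max 0 ((Δ : ℝ) / Real.sqrt (Real.exp 1) - C)) ^ (k * (Δ + 1))) := by 
  refine ⟨⟨Real.exp 2, fun Δ V _ G _ hG hΔ => max_pow_le_numColorings Δ G hG fun u => ?_⟩,
    fun Δ k => numColorings_disjointCliques k (Δ + 1),
    ⟨_, factorial_rpow_sub_isLittleO, fun Δ k => ?_⟩, fun C => ?_⟩
  -- the degrees on the two sides are computed with different decidability instances
  · refine le_trans (le_of_eq ?_) ((G.degree_le_maxDegree u).trans hΔ)
    congr!
  · rw [numColorings_disjointCliques, factorial_pow_eq]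
  · filter_upwards [eventually_add_lt_div_sqrt_sub factorial_rpow_sub_isLittleO C,
      eventually_ge_atTop 2] with Δ hlt hΔ k hk
    refine ⟨maxDegree_disjointCliques hk Δ.succ_pos,
      not_cliqueFree_disjointCliques hk (by omega), ?_⟩
    rw [numColorings_disjointCliques, factorial_pow_eq]
    refine pow_lt_pow_left₀ (hlt.trans_le (le_max_right _ _)) ?_ (by positivity)
    rw [add_sub_cancel]
    positivity
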